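/- Let $X\sim N(0,1)$, let $p\ge 2$, and let $Y=H_p(X)$, where $H_p$ is the monic Hermite polynomial of degree $p$ ($H_0=1$, $H_{n+1}(x)=xH_n(x)-H_n'(x)$). Let $\mathbb K$ be $\mathbb Z$, $\mathbb Q$ or $\mathbb R$ (or, more generally, any subring of $\mathbb R$). Write $y=H_p(x)$, so that $\mathbb K[y]$ is a subring of $\mathbb K[x]$, and let $\langle H_p'(x)\rangle$ be the ideal of $\mathbb K[x]$ generated by $H_p'(x)$. A differential operator $\mathcal S=\sum_{t=0}^T p_t\partial^t$ with $p_0,\dots,p_T\in\mathbb K[y]$ is called a polynomial Stein operator for $Y$ if $\mathcal Sf(Y)$ is integrable and $\mathbb E[\mathcal S f(Y)]=0$ for every $f\in C^T(I)$ such that $\mathbb E|Y^jf^{(t)}(Y)|<\infty$ for all $0\le t\le T$ and $0\le j\le m$, where $I\subseteq\mathbb R$ is the support of $Y$ and $m=\max_t\deg p_t$. (a) The set $\mathbb K[y]\cap\langle H_p'(x)\rangle$ is an ideal of $\mathbb K[y]$. If $\mathbb K$ is a field (in particular if $\mathbb K=\mathbb Q$ or $\mathbb K=\mathbb R$), then the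 polynomial $$t(y)=\prod_{v\in\{H_p(z)\,:\,z\in\mathbb R,\ H_p'(z)=0\}}(y-v),$$ where the product is over the distinct critical values of $H_p$, has its coefficients in $\mathbb K$, and $\mathbb K[y]\cap\langle H_p'(x)\rangle=\langle t(y)\rangle$ as ideals of $\mathbb K[y]$. Now let $\mathcal S=\sum_{t=0}^Tp_t\partial^t$ be any polynomial Stein operator for $Y$ with coefficients in $\mathbb K[y]$. (b) Then $p_T(y)\in\mathbb K[y]\cap\langle H_p'(x)\rangle$, and $p_T(H_p(x))=0$ for every real $x$ with $H_p'(x)=0$. In particular, $p_T$ vanishes at every local minimum value and every local maximum value of $H_p$. (c) If $p_T\ne0$, then $\deg p_T\ge p/2$ when $p$ is even, and $\deg p_T\ge p-1$ when $p$ is odd. -/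

import Mathlib

open Polynomial MeasureTheory ProbabilityTheory

noncomputable section

/-! ### The algebraic side -/

/-- The (probabilists', monic) Hermite polynomial `H_p`, with coefficients in `K`:
`H_0 = 1` and `H_{n+1} = x H_n - H_n'`. -/
def hermiteOver (K : Type*) [CommRing K] (p : ℕ) : K[X] :=
  (hermite p).map (Int.castRingHom K)

/-- The subring `K[y]` of `K[x]`, where `y = H_p(x)`. -/
def hermiteSubring (K : Type*) [CommRing K] (p : ℕ) : Subalgebra K K[X] :=
  Algebra.adjoin K {hermiteOver K p}

/-- The variable `y = H_p(x)`, as an element of the subring `K[y]`. -/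
def hermiteVar (K : Type*) [CommRing K] (p : ℕ) : hermiteSubring K p :=
  ⟨hermiteOver K p, Algebra.self_mem_adjoin_singleton K _⟩

/-- `K[y] ∩ ⟨H_p'(x)⟩`, as an ideal of the subring `K[y]`; here `⟨H_p'(x)⟩` is the ideal of `K[x]`
generated by `H_p'(x)`. -/
def criticalIdeal (K : Type*) [CommRing K] (p : ℕ) : Ideal (hermiteSubring K p) :=
  (Ideal.span {derivative (hermiteOver K p)}).comap (hermiteSubring K p).val

/-- The finite set `{H_p(z) : H_p'(z) = 0}` of critical values of `H_p`. (For `p = 0`, where `H_p'`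
vanishes identically, this is the empty set.) -/
def criticalValues (p : ℕ) : Finset ℝ :=
  (derivative (hermiteOver ℝ p)).roots.toFinset.image fun z => (hermiteOver ℝ p).eval z

/-- `t(y) = ∏ (y - v)`, the product over the distinct critical values `v` of `H_p`. -/
def criticalPolynomial (p : ℕ) : ℝ[X] :=
  ∏ v ∈ criticalValues p, (X - C v)

/-! ### Polynomial Stein operators -/

variable {Ω : Type*} [MeasurableSpace Ω]

/-- The support of the law of the random variable `Y`. -/
def lawSupport (P : Measure Ω) (Y : Ω → ℝ) : Set ℝ :=
  (P.map Y).support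

/-- The largest degree `m` of the coefficients `c_0, …, c_T`. -/
def maxCoeffDegree {K : Type*} [CommRing K] {T : ℕ} (c : Fin (T + 1) → K[X]) : ℕ :=
  Finset.univ.sup fun t => (c t).natDegree

/-- The class of functions on which the operator `∑ c_t ∂^t` acts: those `f ∈ C^T(I)`, where `I` is
the support of `Y`, with `E|Y^j f^{(t)}(Y)| < ∞` for all `t = 0, …, T` and `j = 0, …, m`, where
`m` is the largest degree of the coefficients. -/
def steinClass {K : Type*} [CommRing K] (P : Measure Ω) (Y : Ω → ℝ) {T : ℕ}
    (c : Fin (T + 1) → K[X]) : Set (ℝ → ℝ) :=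
  {f | ContDiffOn ℝ T f (lawSupport P Y) ∧
    ∀ t ≤ T, ∀ j ≤ maxCoeffDegree c,
      Integrable (fun ω => Y ω ^ j * iteratedDerivWithin t f (lawSupport P Y) (Y ω)) P}

/-- `(∑ c_t ∂^t) f`, for `f` defined on `I ⊆ ℝ`. -/
def steinApply {K : Type*} [CommRing K] [Algebra K ℝ] {T : ℕ} (c : Fin (T + 1) → K[X])
    (I : Set ℝ) (f : ℝ → ℝ) (y : ℝ) : ℝ :=
  ∑ t : Fin (T + 1), aeval y (c t) * iteratedDerivWithin (t : ℕ) f I y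

/-- `∑_{t=0}^T c_t ∂^t`, with coefficients in `K[y]`, is a polynomial Stein operator for `Y`. -/
def IsPolynomialSteinOperator {K : Type*} [CommRing K] [Algebra K ℝ] (P : Measure Ω) (Y : Ω → ℝ)
    {T : ℕ} (c : Fin (T + 1) → K[X]) : Prop :=
  ∀ f ∈ steinClass P Y c,
    Integrable (fun ω => steinApply c (lawSupport P Y) f (Y ω)) P ∧
      ∫ ω, steinApply c (lawSupport P Y) f (Y ω) ∂P = 0

end

/-! ### Hermite identities: derivative, parity, simple zeros. -/

section HermiteBasics

variable (K : Type*) [CommRing K]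

/-! Write `H = H_p` and `h = H_{p-1}`, so `H' = p h`. Test the operator on a bump `f` whose support
lies in `(H(a), H(b))` with `a` large. By parity only the branch `[a, b]` matters: its mirror image
contributes the same for even `p` and nothing for odd `p`. There `f^{(k+1)}(H) = (p h)⁻¹ d/dx
f^{(k)}(H)`, so `T` integrations by parts against the Gaussian weight put all derivatives on the
coefficients and leave the integral of `e^{-x²/2} G_T / (p^T h^{2T}) f(H)`, which must be zero. A
nonzero polynomial `G_T` has constant sign far out, so `G_T = 0`
(`steinNumerator_eq_zero_of_isPolynomialSteinOperator`).

The rest is algebra on the recursion for `G_s`, which starts at `G_0 = p_T(H)`. At a zero `z` of `h`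
it reads `G_{s+1}(z) = (2s+1) G_s(z) h'(z)`; the zeros of `h` are simple and real, so `h` divides
`p_T(H)`. Modulo `p`, a degree count shows that a nonzero `G_s` stays nonzero, so `p` divides
`p_T(H)` as well. As `h` is monic, `p h = H'` divides `p_T(H)`.

Over `ℝ`, `H'` is a constant times a product of distinct linear factors, so `H' ∣ q(H)` means that
`q` vanishes at every critical value. This gives the generator `t`, and bounds `deg p_T` below by
the number of critical values, which Sonin's function counts. -/

theorem hermiteOver_zero : hermiteOver K 0 = 1 := by simp [hermiteOver]

theorem hermiteOver_succ (n : ℕ) :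
    hermiteOver K (n + 1) = X * hermiteOver K n - derivative (hermiteOver K n) := by
  simp [hermiteOver, derivative_map]

theorem derivative_hermiteOver_succ (n : ℕ) :
    derivative (hermiteOver K (n + 1)) = ((n + 1 : ℕ) : K[X]) * hermiteOver K n := by
  induction n with
  | zero => simp [hermiteOver_succ, hermiteOver_zero]
  | succ n ih =>
    rw [hermiteOver_succ K (n + 1), derivative_sub, derivative_mul, ih, derivative_mul,
      derivative_natCast, derivative_X, hermiteOver_succ K n]
    push_cast
    ring

theorem hermiteOver_monic (n : ℕ) : (hermiteOver K n).Monic :=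
  (hermite_monic n).map _

theorem natDegree_hermiteOver [Nontrivial K] (n : ℕ) : (hermiteOver K n).natDegree = n := by
  rw [hermiteOver, (hermite_monic n).natDegree_map, natDegree_hermite]

theorem map_hermiteOver {L : Type*} [CommRing L] (φ : K →+* L) (n : ℕ) :
    (hermiteOver K n).map φ = hermiteOver L n := by
  rw [hermiteOver, hermiteOver, Polynomial.map_map]
  congr 1
  exact RingHom.ext_int _ _

variable {K}

theorem hermiteOver_comp_neg_X (n : ℕ) :
    (hermiteOver K n).comp (-X) = (-1) ^ n * hermiteOver K n := by
  induction n with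
  | zero => simp [hermiteOver_zero]
  | succ n ih =>
    have h := congrArg derivative ih
    have h1 : derivative ((-1 : K[X]) ^ n) = 0 := by
      rw [← C_1, ← C_neg, ← C_pow, derivative_C]
    rw [derivative_comp, derivative_mul, h1, derivative_neg, derivative_X] at h
    rw [hermiteOver_succ, sub_comp, mul_comp, X_comp, ih]
    linear_combination h

theorem eval_neg_hermiteOver (n : ℕ) (x : K) :
    (hermiteOver K n).eval (-x) = (-1) ^ n * (hermiteOver K n).eval x := by
  have h := congrArg (eval x) (hermiteOver_comp_neg_X (K := K) n)
  simpa using h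

/-- A double zero of `H_{n+1}` is a zero of `H_n`, and the recursion then makes it a double zero of
`H_n`; descend to `H_0 = 1`. -/
theorem eval_derivative_hermiteOver_ne_zero [IsDomain K] [CharZero K] (n : ℕ) {z : K}
    (hz : (hermiteOver K n).eval z = 0) : (derivative (hermiteOver K n)).eval z ≠ 0 := by
  induction n with
  | zero => simp [hermiteOver_zero] at hz
  | succ n ih =>
    intro h
    rw [derivative_hermiteOver_succ, eval_mul, eval_natCast, mul_eq_zero] at h
    have h0 := h.resolve_left (Nat.cast_ne_zero.mpr n.succ_ne_zero)
    refine ih h0 ?_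
    rw [hermiteOver_succ] at hz
    simpa [h0] using hz

end HermiteBasics

/-! ### Real zeros of Hermite polynomials. -/

section HermiteRoots

theorem tendsto_eval_mul_exp_neg_sq_cocompact (f : ℝ[X]) :
    Filter.Tendsto (fun x : ℝ => f.eval x * Real.exp (-(x ^ 2 / 2)))
      (Filter.cocompact ℝ) (nhds 0) := by
  induction f using Polynomial.induction_on' with
  | add p q hp hq => simpa [add_mul] using hp.add hq
  | monomial n a =>
    have h := tendsto_rpow_abs_mul_exp_neg_mul_sq_cocompact (a := (1 / 2 : ℝ)) (by norm_num) n
    rw [tendsto_zero_iff_abs_tendsto_zero]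
    have h2 := h.const_mul |a|
    rw [mul_zero] at h2
    refine h2.congr fun x => ?_
    simp only [Function.comp, eval_monomial, abs_mul, abs_pow, Real.abs_exp, Real.rpow_natCast]
    rw [mul_assoc]
    congr 4
    ring

theorem hasDerivAt_eval_mul_exp_neg_sq (f : ℝ[X]) (x : ℝ) :
    HasDerivAt (fun x : ℝ => f.eval x * Real.exp (-(x ^ 2 / 2)))
      (-(X * f - derivative f).eval x * Real.exp (-(x ^ 2 / 2))) x := by
  have h1 : HasDerivAt (fun x : ℝ => Real.exp (-(x ^ 2 / 2)))
      (Real.exp (-(x ^ 2 / 2)) * (-x)) x := by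
    have h : HasDerivAt (fun x : ℝ => -(x ^ 2 / 2)) (-x) x := by
      have := (((hasDerivAt_id x).pow 2).div_const 2).neg
      refine this.congr_deriv ?_
      simp only [id]
      ring
    exact h.exp
  refine ((f.hasDerivAt x).mul h1).congr_deriv ?_
  simp only [eval_sub, eval_mul, eval_X]
  ring

/-- Rolle's theorem for `f e^{-x²/2}`, whose derivative is `-(x f - f') e^{-x²/2}`. This function
also vanishes at `±∞`, which supplies two extra nodes. -/
theorem card_roots_lt_card_roots_X_mul_sub_derivative {f : ℝ[X]}
    (hq : X * f - derivative f ≠ 0) :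
    f.roots.toFinset.card + 1 ≤ (X * f - derivative f).roots.toFinset.card := by
  classical
  rcases eq_or_ne f 0 with rfl | hf
  · simp at hq
  set q := X * f - derivative f with hqdef
  set r := f.roots.toFinset.image Real.arctan with hr
  have hcr : r.card = f.roots.toFinset.card :=
    Finset.card_image_of_injective _ Real.arctan_injective
  set t := q.roots.toFinset.image Real.arctan
  have hct : t.card = q.roots.toFinset.card :=
    Finset.card_image_of_injective _ Real.arctan_injective
  have hrlt : ∀ x ∈ r, -(Real.pi / 2) < x ∧ x < Real.pi / 2 ∧ f.eval (Real.tan x) = 0 := by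
    intro x hx
    obtain ⟨y, hy, rfl⟩ := Finset.mem_image.1 hx
    refine ⟨Real.neg_pi_div_two_lt_arctan y, Real.arctan_lt_pi_div_two y, ?_⟩
    rw [Real.tan_arctan]
    simpa [hf] using hy
  -- In the coordinate `arctan x`, the points `±∞` become the endpoints `±π/2`.
  set s : Finset ℝ := insert (-(Real.pi / 2)) (insert (Real.pi / 2) r)
  have hcs : s.card = r.card + 2 := by
    rw [Finset.card_insert_of_notMem, Finset.card_insert_of_notMem]
    · exact fun h => (hrlt _ h).2.1.false
    · intro h
      rcases Finset.mem_insert.1 h with h | h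
      · linarith [Real.pi_pos]
      · exact (hrlt _ h).1.false
  have hmem : ∀ x ∈ s, x = -(Real.pi / 2) ∨ x = Real.pi / 2 ∨ x ∈ r := by
    intro x hx; simpa [s] using hx
  have key : s.card ≤ t.card + 1 := by
    refine Finset.card_le_of_interleaved fun x hx y hy hxy _ => ?_
    set ψ : ℝ → ℝ := fun x => f.eval x * Real.exp (-(x ^ 2 / 2)) with hψ
    have hψc : Continuous ψ := by fun_prop
    have hlim : Filter.Tendsto ψ (Filter.atBot ⊔ Filter.atTop) (nhds 0) := by
      rw [← cocompact_eq_atBot_atTop]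
      exact tendsto_eval_mul_exp_neg_sq_cocompact f
    have hcont : ∀ z ∈ r, Filter.Tendsto (fun u => ψ (Real.tan u)) (nhds z) (nhds 0) := by
      intro z hz
      obtain ⟨h1, h2, h3⟩ := hrlt z hz
      have hc : ContinuousAt (fun u => ψ (Real.tan u)) z :=
        hψc.continuousAt.comp
          (Real.continuousAt_tan.2 (Real.cos_pos_of_mem_Ioo ⟨h1, h2⟩).ne')
      have h0 : ψ (Real.tan z) = 0 := by simp [hψ, h3]
      have := hc.tendsto
      rwa [h0] at this
    have hx' : -(Real.pi / 2) ≤ x := by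
      rcases hmem x hx with h | h | h
      · exact h.ge
      · linarith [Real.pi_pos]
      · exact (hrlt x h).1.le
    have hy' : y ≤ Real.pi / 2 := by
      rcases hmem y hy with h | h | h
      · linarith [Real.pi_pos]
      · exact h.le
      · exact (hrlt y h).2.1.le
    have hcos : ∀ z ∈ Set.Ioo x y, Real.cos z ≠ 0 := fun z hz =>
      (Real.cos_pos_of_mem_Ioo ⟨hx'.trans_lt hz.1, hz.2.trans_le hy'⟩).ne'
    obtain ⟨c, hc, hc0⟩ := exists_hasDerivAt_eq_zero' (f := fun u => ψ (Real.tan u)) (l := 0)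
      (f' := fun u => -q.eval (Real.tan u) * Real.exp (-(Real.tan u ^ 2 / 2)) *
        (1 / Real.cos u ^ 2)) hxy
      (by
        rcases hmem x hx with h | h | h
        · rw [h]
          exact (hlim.mono_left le_sup_left).comp Real.tendsto_tan_neg_pi_div_two
        · exact absurd (hxy.trans_le hy') (by rw [h]; exact lt_irrefl _)
        · exact (hcont x h).mono_left nhdsWithin_le_nhds)
      (by
        rcases hmem y hy with h | h | h
        · exact absurd (hx'.trans_lt hxy) (by rw [h]; exact lt_irrefl _)
        · rw [h]
          exact (hlim.mono_left le_sup_right).comp Real.tendsto_tan_pi_div_two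
        · exact (hcont y h).mono_left nhdsWithin_le_nhds)
      (fun z hz => (hasDerivAt_eval_mul_exp_neg_sq f (Real.tan z)).comp z
        (Real.hasDerivAt_tan (hcos z hz)))
    refine ⟨c, Finset.mem_image.2 ⟨Real.tan c, ?_, ?_⟩, hc.1, hc.2⟩
    · have h := hcos c hc
      have : q.eval (Real.tan c) = 0 := by simpa [h, Real.exp_ne_zero] using hc0
      simpa [hq] using this
    · exact Real.arctan_tan (hx'.trans_lt hc.1) (hc.2.trans_le hy')
  omega

theorem card_roots_hermiteOver (n : ℕ) : (hermiteOver ℝ n).roots.toFinset.card = n := by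
  refine le_antisymm ?_ ?_
  · exact ((Multiset.toFinset_card_le _).trans (card_roots' _)).trans
      (natDegree_hermiteOver ℝ n).le
  · induction n with
    | zero => exact Nat.zero_le _
    | succ n ih =>
      have h := card_roots_lt_card_roots_X_mul_sub_derivative (f := hermiteOver ℝ n)
        (by rw [← hermiteOver_succ]; exact (hermiteOver_monic ℝ _).ne_zero)
      rw [hermiteOver_succ]
      omega

theorem mem_roots_toFinset_hermiteOver {n : ℕ} {z : ℝ} :
    z ∈ (hermiteOver ℝ n).roots.toFinset ↔ (hermiteOver ℝ n).eval z = 0 := by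
  simp [(hermiteOver_monic ℝ n).ne_zero]

theorem hermiteOver_dvd_of_forall_root {n : ℕ} {q : ℝ[X]}
    (h : ∀ z, (hermiteOver ℝ n).eval z = 0 → q.eval z = 0) : hermiteOver ℝ n ∣ q := by
  classical
  have hprod : ∏ z ∈ (hermiteOver ℝ n).roots.toFinset, (X - C z) = hermiteOver ℝ n := by
    have hcard : (hermiteOver ℝ n).roots.card = (hermiteOver ℝ n).natDegree :=
      le_antisymm (card_roots' _) (by
        rw [natDegree_hermiteOver]
        exact (card_roots_hermiteOver n).ge.trans (Multiset.toFinset_card_le _))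
    have hnd : (hermiteOver ℝ n).roots.Nodup := by
      rw [← Multiset.toFinset_card_eq_card_iff_nodup, card_roots_hermiteOver, hcard,
        natDegree_hermiteOver]
    rw [Finset.prod, Multiset.toFinset_val, hnd.dedup]
    exact prod_multiset_X_sub_C_of_monic_of_roots_card_eq (hermiteOver_monic ℝ n) hcard
  rw [← hprod]
  refine Finset.prod_dvd_of_coprime ?_ fun z hz => ?_
  · intro a _ b _ hab
    exact pairwise_coprime_X_sub_C Function.injective_id hab
  · exact dvd_iff_isRoot.2 (h z (mem_roots_toFinset_hermiteOver.1 hz))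

end HermiteRoots

/-! ### The critical ideal and its generator. -/

section CriticalIdeal

theorem coe_aeval_hermiteVar {K : Type*} [CommRing K] (p : ℕ) (q : K[X]) :
    ((aeval (hermiteVar K p) q : hermiteSubring K p) : K[X]) = aeval (hermiteOver K p) q :=
  (aeval_algHom_apply (hermiteSubring K p).val (hermiteVar K p) q).symm

theorem mem_criticalIdeal_iff {K : Type*} [CommRing K] {p : ℕ} {g : hermiteSubring K p} :
    g ∈ criticalIdeal K p ↔ derivative (hermiteOver K p) ∣ (g : K[X]) := by
  rw [criticalIdeal, Ideal.mem_comap, Ideal.mem_span_singleton]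
  rfl

theorem exists_aeval_hermiteVar_eq {K : Type*} [CommRing K] {p : ℕ} (g : hermiteSubring K p) :
    ∃ q : K[X], aeval (hermiteVar K p) q = g := by
  have h : (g : K[X]) ∈ Algebra.adjoin K {hermiteOver K p} := g.2
  rw [Algebra.adjoin_singleton_eq_range_aeval] at h
  obtain ⟨q, hq⟩ := h
  exact ⟨q, Subtype.ext ((coe_aeval_hermiteVar p q).trans hq)⟩

theorem derivative_hermiteOver_ne_zero {p : ℕ} (hp : p ≠ 0) :
    derivative (hermiteOver ℝ p) ≠ 0 := by
  obtain ⟨n, rfl⟩ := Nat.exists_eq_succ_of_ne_zero hp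
  rw [Nat.succ_eq_add_one, derivative_hermiteOver_succ]
  exact mul_ne_zero (Nat.cast_ne_zero.2 n.succ_ne_zero) (hermiteOver_monic ℝ n).ne_zero

theorem mem_criticalValues_iff {p : ℕ} (hp : p ≠ 0) {v : ℝ} :
    v ∈ criticalValues p ↔
      ∃ z, (derivative (hermiteOver ℝ p)).eval z = 0 ∧ (hermiteOver ℝ p).eval z = v := by
  simp [criticalValues, derivative_hermiteOver_ne_zero hp]

theorem criticalPolynomial_monic (p : ℕ) : (criticalPolynomial p).Monic :=
  monic_prod_of_monic _ _ fun v _ => monic_X_sub_C v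

theorem criticalPolynomial_dvd_iff {p : ℕ} {q : ℝ[X]} :
    criticalPolynomial p ∣ q ↔ ∀ v ∈ criticalValues p, q.eval v = 0 := by
  refine ⟨fun h v hv => ?_, fun h => ?_⟩
  · exact dvd_iff_isRoot.1 ((Finset.dvd_prod_of_mem (fun v => X - C v) hv).trans h)
  · refine Finset.prod_dvd_of_coprime ?_ fun v hv => dvd_iff_isRoot.2 (h v hv)
    intro a _ b _ hab
    exact pairwise_coprime_X_sub_C Function.injective_id hab

theorem derivative_hermiteOver_dvd_iff_forall_root {p : ℕ} (hp : p ≠ 0) {q : ℝ[X]} :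
    derivative (hermiteOver ℝ p) ∣ q ↔
      ∀ z, (derivative (hermiteOver ℝ p)).eval z = 0 → q.eval z = 0 := by
  refine ⟨fun ⟨r, hr⟩ z hz => by rw [hr, eval_mul, hz, zero_mul], fun h => ?_⟩
  obtain ⟨n, rfl⟩ := Nat.exists_eq_succ_of_ne_zero hp
  rw [Nat.succ_eq_add_one, derivative_hermiteOver_succ] at h ⊢
  have hu : IsUnit ((n + 1 : ℕ) : ℝ[X]) := by
    rw [← C_eq_natCast]
    exact isUnit_C.2 (Nat.cast_ne_zero.2 n.succ_ne_zero).isUnit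
  exact hu.mul_left_dvd.2 (hermiteOver_dvd_of_forall_root fun z hz => h z (by simp [hz]))

theorem derivative_hermiteOver_dvd_aeval_iff {p : ℕ} (hp : p ≠ 0) {q : ℝ[X]} :
    derivative (hermiteOver ℝ p) ∣ aeval (hermiteOver ℝ p) q ↔ criticalPolynomial p ∣ q := by
  rw [derivative_hermiteOver_dvd_iff_forall_root hp, criticalPolynomial_dvd_iff]
  have key : ∀ z, (aeval (hermiteOver ℝ p) q).eval z = q.eval ((hermiteOver ℝ p).eval z) := by
    intro z
    rw [← comp_eq_aeval, eval_comp]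
  simp only [key, mem_criticalValues_iff hp]
  constructor
  · rintro h v ⟨z, hz, rfl⟩
    exact h z hz
  · exact fun h z hz => h _ ⟨z, hz, rfl⟩

/-- The map `L[x] → K[x]` applying a `K`-linear map `L → K` to every coefficient. -/
noncomputable def coeffMap {K L : Type*} [CommRing K] [CommRing L] [Algebra K L]
    (φ : L →ₗ[K] K) (q : L[X]) : K[X] :=
  ∑ i ∈ Finset.range (q.natDegree + 1), monomial i (φ (q.coeff i))

theorem coeff_coeffMap {K L : Type*} [CommRing K] [CommRing L] [Algebra K L]
    (φ : L →ₗ[K] K) (q : L[X]) (n : ℕ) : (coeffMap φ q).coeff n = φ (q.coeff n) := by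
  simp only [coeffMap, finsetSum_coeff, coeff_monomial, Finset.sum_ite_eq', Finset.mem_range]
  split_ifs with h
  · rfl
  · rw [coeff_eq_zero_of_natDegree_lt (by omega), map_zero]

theorem coeffMap_mul_map {K L : Type*} [CommRing K] [CommRing L] [Algebra K L]
    (φ : L →ₗ[K] K) (q : L[X]) (r : K[X]) :
    coeffMap φ (r.map (algebraMap K L) * q) = r * coeffMap φ q := by
  ext n
  simp only [coeff_coeffMap, coeff_mul, coeff_map, map_sum, ← Algebra.smul_def, map_smul,
    smul_eq_mul]

/-- With `coeffMap_mul_map`, this carries a real identity `H' r = t(H)` down to `K[x]`, because `H`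
and `H'` have coefficients in `K`. -/
theorem coeffMap_aeval_map {K L : Type*} [CommRing K] [CommRing L] [Algebra K L]
    (φ : L →ₗ[K] K) (q : L[X]) (r : K[X]) :
    coeffMap φ (aeval (r.map (algebraMap K L)) q) = aeval r (coeffMap φ q) := by
  ext n
  rw [coeff_coeffMap, aeval_eq_sum_range, coeffMap, map_sum, finsetSum_coeff, finsetSum_coeff,
    map_sum]
  refine Finset.sum_congr rfl fun i _ => ?_
  rw [coeff_smul, ← Polynomial.map_pow, coeff_map, smul_eq_mul, mul_comm, ← Algebra.smul_def,
    map_smul, aeval_monomial, smul_eq_mul, mul_comm, Polynomial.algebraMap_eq, coeff_C_mul]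

theorem exists_map_eq_criticalPolynomial {K : Type*} [Field K] [Algebra K ℝ] {p : ℕ}
    (hp : p ≠ 0) :
    ∃ t : K[X], t.map (algebraMap K ℝ) = criticalPolynomial p ∧
      criticalIdeal K p = Ideal.span {aeval (hermiteVar K p) t} := by
  have hinj : Function.Injective (algebraMap K ℝ) := (algebraMap K ℝ).injective
  -- A `K`-linear retraction `ℝ → K` exists because `K` is a field. Applied to the coefficients of
  -- the real generator it gives a monic element of the same degree in the ideal over `K`, which
  -- must be that generator.
  obtain ⟨φ, hφ⟩ := (Algebra.linearMap K ℝ).exists_leftInverse_of_injective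
    (LinearMap.ker_eq_bot.2 hinj)
  have hφ1 : φ 1 = 1 := by
    have := LinearMap.congr_fun hφ 1
    simpa using this
  have hH : (hermiteOver K p).map (algebraMap K ℝ) = hermiteOver ℝ p := map_hermiteOver K _ p
  have hH' : (derivative (hermiteOver K p)).map (algebraMap K ℝ) = derivative (hermiteOver ℝ p) := by
    rw [← derivative_map, hH]
  have haeval : ∀ q : K[X], (aeval (hermiteOver K p) q).map (algebraMap K ℝ) =
      aeval (hermiteOver ℝ p) (q.map (algebraMap K ℝ)) := by
    intro q
    rw [← comp_eq_aeval, ← comp_eq_aeval, map_comp, hH]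
  have hdvd : ∀ q : K[X], derivative (hermiteOver K p) ∣ aeval (hermiteOver K p) q ↔
      criticalPolynomial p ∣ q.map (algebraMap K ℝ) := by
    intro q
    rw [← map_dvd_map' (algebraMap K ℝ), hH', haeval, derivative_hermiteOver_dvd_aeval_iff hp]
  have ht1 := criticalPolynomial_monic p
  set t := coeffMap φ (criticalPolynomial p) with ht
  have htdeg : t.natDegree ≤ (criticalPolynomial p).natDegree := by
    rw [natDegree_le_iff_coeff_eq_zero]
    intro n hn
    rw [ht, coeff_coeffMap, coeff_eq_zero_of_natDegree_lt hn, map_zero]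
  have htm : t.Monic := by
    refine monic_of_natDegree_le_of_coeff_eq_one _ htdeg ?_
    rw [ht, coeff_coeffMap, ht1.coeff_natDegree, hφ1]
  have htmem : derivative (hermiteOver K p) ∣ aeval (hermiteOver K p) t := by
    obtain ⟨r, hr⟩ := (derivative_hermiteOver_dvd_aeval_iff hp).2 (dvd_refl (criticalPolynomial p))
    refine ⟨coeffMap φ r, ?_⟩
    rw [ht, ← coeffMap_aeval_map, ← coeffMap_mul_map, hH, hH', hr]
  have htmap : t.map (algebraMap K ℝ) = criticalPolynomial p :=
    (eq_of_monic_of_dvd_of_natDegree_le ht1 (htm.map _) ((hdvd t).1 htmem)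
      (by rwa [htm.natDegree_map]))
  refine ⟨t, htmap, le_antisymm (fun g hg => ?_) ?_⟩
  · obtain ⟨q, rfl⟩ := exists_aeval_hermiteVar_eq g
    rw [mem_criticalIdeal_iff, coe_aeval_hermiteVar, hdvd, ← htmap, map_dvd_map'] at hg
    exact Ideal.mem_span_singleton.2 (map_dvd _ hg)
  · rw [Ideal.span_singleton_le_iff_mem, mem_criticalIdeal_iff, coe_aeval_hermiteVar]
    exact htmem

theorem image_criticalIdeal (K : Type*) [CommRing K] (p : ℕ) :
    (Subtype.val '' (criticalIdeal K p : Set (hermiteSubring K p)) : Set K[X]) =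
      (hermiteSubring K p : Set K[X]) ∩
        (Ideal.span {derivative (hermiteOver K p)} : Ideal K[X]) := by
  ext g
  constructor
  · rintro ⟨a, ha, rfl⟩
    exact ⟨a.2, ha⟩
  · rintro ⟨h1, h2⟩
    exact ⟨⟨g, h1⟩, h2, rfl⟩

end CriticalIdeal

/-! ### Counting critical values. -/

section CriticalValues

theorem hermiteOver_ode (n : ℕ) (x : ℝ) :
    (derivative (derivative (hermiteOver ℝ (n + 1)))).eval x =
      x * (derivative (hermiteOver ℝ (n + 1))).eval x -
        (n + 1) * (hermiteOver ℝ (n + 1)).eval x := by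
  rw [derivative_hermiteOver_succ, derivative_mul, derivative_natCast, hermiteOver_succ ℝ n]
  simp
  ring

/-- Sonin's function `H² + H'²/(n+1)` is strictly increasing on `[0, ∞)`. -/
theorem strictMonoOn_sonin (n : ℕ) :
    StrictMonoOn (fun x : ℝ => (hermiteOver ℝ (n + 1)).eval x ^ 2 +
      (derivative (hermiteOver ℝ (n + 1))).eval x ^ 2 / (n + 1)) (Set.Ici 0) := by
  set H := hermiteOver ℝ (n + 1) with hH
  set S : ℝ[X] := C ((n : ℝ) + 1) * H ^ 2 + derivative H ^ 2 with hS
  have hn : (0 : ℝ) < n + 1 := by positivity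
  -- The Hermite equation `H'' = x H' - (n+1) H` cancels the terms in `H H'`.
  have hS' : derivative S = 2 * X * derivative H ^ 2 := by
    refine Polynomial.funext fun x => ?_
    have := hermiteOver_ode n x
    rw [← hH] at this
    simp only [hS, derivative_add, derivative_C_mul, derivative_pow, eval_add, eval_mul, eval_C,
      eval_pow, this, eval_X]
    simp
    ring
  have hdiff : ∀ x y : ℝ, 0 ≤ x → x < y → S.eval x < S.eval y := by
    have hmono : MonotoneOn (fun x => S.eval x) (Set.Ici 0) := by
      refine monotoneOn_of_deriv_nonneg (convex_Ici 0) S.continuous.continuousOn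
        S.differentiable.differentiableOn fun x hx => ?_
      rw [interior_Ici] at hx
      rw [Polynomial.deriv, hS']
      have : (0 : ℝ) < x := hx
      simp only [eval_mul, eval_ofNat, eval_X, eval_pow]
      positivity
    intro x y hx hxy
    refine lt_of_le_of_ne (hmono hx (hx.trans hxy.le) hxy.le) fun heq => ?_
    -- Equal values at `x < y` would make `S` constant between them, hence `S' = 0` as a polynomial.
    have hconst : ∀ z ∈ Set.Ioo x y, (derivative S).eval z = 0 := by
      intro z hz
      have hev : (fun u => S.eval u) =ᶠ[nhds z] fun _ => S.eval x := by
        filter_upwards [Ioo_mem_nhds hz.1 hz.2] with u hu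
        exact le_antisymm ((hmono (hx.trans hu.1.le) (hx.trans hxy.le) hu.2.le).trans heq.ge)
          (hmono hx (hx.trans hu.1.le) hu.1.le)
      rw [← Polynomial.deriv, hev.deriv_eq, deriv_const]
    have hz : derivative S = 0 :=
      eq_zero_of_infinite_isRoot _ ((Set.Ioo_infinite hxy).mono hconst)
    rw [hS'] at hz
    have h2 : (2 * X : ℝ[X]) ≠ 0 := mul_ne_zero two_ne_zero X_ne_zero
    exact mul_ne_zero h2 (pow_ne_zero 2 (derivative_hermiteOver_ne_zero n.succ_ne_zero)) hz
  have hform : ∀ x, H.eval x ^ 2 + (derivative H).eval x ^ 2 / (n + 1) = S.eval x / (n + 1) := by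
    intro x
    simp only [hS, eval_add, eval_mul, eval_C, eval_pow]
    field_simp
  intro x hx y _ hxy
  simp only [hform]
  exact div_lt_div_of_pos_right (hdiff x y hx hxy) hn

/-- At zeros of `H_n`, that is, critical points of `H_{n+1}`, Sonin's function reduces to
`H_{n+1}²`; parity moves both points to `[0, ∞)`, where it is injective. -/
theorem abs_eq_abs_of_sq_eval_hermiteOver_eq {n : ℕ} {x y : ℝ}
    (hx : (hermiteOver ℝ n).eval x = 0) (hy : (hermiteOver ℝ n).eval y = 0)
    (h : (hermiteOver ℝ (n + 1)).eval x ^ 2 = (hermiteOver ℝ (n + 1)).eval y ^ 2) :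
    |x| = |y| := by
  have habs : ∀ z : ℝ, |z| = z ∨ |z| = -z := fun z => abs_choice z
  have hpar : ∀ (m : ℕ) (z : ℝ),
      (hermiteOver ℝ m).eval |z| ^ 2 = (hermiteOver ℝ m).eval z ^ 2 := by
    intro m z
    rcases habs z with h | h
    · rw [h]
    · rw [h, eval_neg_hermiteOver, mul_pow, ← pow_mul, mul_comm m 2, pow_mul]
      simp
  refine (strictMonoOn_sonin n).injOn (abs_nonneg x) (abs_nonneg y) ?_
  simp only [derivative_hermiteOver_succ, eval_mul, mul_pow, hpar, hx, hy, h,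
    eval_natCast]

theorem le_card_criticalValues_of_odd {p : ℕ} (hp : Odd p) : p - 1 ≤ (criticalValues p).card := by
  obtain ⟨k, rfl⟩ := hp
  have hinj : Set.InjOn (fun z => (hermiteOver ℝ (2 * k + 1)).eval z)
      (hermiteOver ℝ (2 * k)).roots.toFinset := by
    intro x hx y hy hxy
    simp only [Finset.mem_coe, mem_roots_toFinset_hermiteOver] at hx hy hxy
    have h := abs_eq_abs_of_sq_eval_hermiteOver_eq hx hy (by rw [hxy])
    rcases abs_eq_abs.1 h with h | h
    · exact h
    -- If `x = -y`, oddness forces the critical value to be zero, contradicting simplicity of the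
    -- zeros.
    · exfalso
      rw [h, eval_neg_hermiteOver, pow_succ, pow_mul] at hxy
      have h0 : (hermiteOver ℝ (2 * k + 1)).eval y = 0 := by
        simp at hxy
        linarith
      refine eval_derivative_hermiteOver_ne_zero _ h0 ?_
      rw [derivative_hermiteOver_succ, eval_mul, hy, mul_zero]
  have hcard := Finset.card_image_of_injOn hinj
  rw [card_roots_hermiteOver] at hcard
  rw [Nat.add_sub_cancel]
  refine hcard.ge.trans (Finset.card_le_card fun v hv => ?_)
  obtain ⟨z, hz, rfl⟩ := Finset.mem_image.1 hv
  rw [mem_roots_toFinset_hermiteOver] at hz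
  refine (mem_criticalValues_iff (Nat.succ_ne_zero _)).2 ⟨z, ?_, rfl⟩
  rw [derivative_hermiteOver_succ, eval_mul, hz, mul_zero]

theorem le_two_mul_card_criticalValues_of_even {p : ℕ} (hp0 : p ≠ 0) (hp : Even p) :
    p ≤ 2 * (criticalValues p).card := by
  obtain ⟨n, rfl⟩ := Nat.exists_eq_succ_of_ne_zero hp0
  rw [Nat.succ_eq_add_one] at *
  have hodd : Odd n := by
    rcases Nat.even_or_odd n with h | h
    · exact absurd hp (by simpa [Nat.even_add_one] using h)
    · exact h
  have h0 : (hermiteOver ℝ n).eval 0 = 0 := by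
    have := eval_neg_hermiteOver (K := ℝ) n 0
    rw [hodd.neg_one_pow, neg_zero] at this
    linarith
  set R := (hermiteOver ℝ n).roots.toFinset with hR
  have hRc : R.card = n := card_roots_hermiteOver n
  -- `A` consists of the nonnegative critical points. It contains `0`, so reflection counts `n ≤
  -- 2|A| - 1`.
  set A := R.image fun z => |z|
  have hAB : R ⊆ A ∪ (A.erase 0).image fun z => -z := by
    intro z hz
    have hzA : |z| ∈ A := Finset.mem_image_of_mem _ hz
    rcases le_or_gt 0 z with h | h
    · rw [abs_of_nonneg h] at hzA
      exact Finset.mem_union_left _ hzA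
    · refine Finset.mem_union_right _ (Finset.mem_image.2 ⟨|z|, Finset.mem_erase.2
        ⟨(abs_pos.2 h.ne).ne', hzA⟩, ?_⟩)
      rw [abs_of_neg h, neg_neg]
  have h0A : (0 : ℝ) ∈ A :=
    Finset.mem_image.2 ⟨0, mem_roots_toFinset_hermiteOver.2 h0, abs_zero⟩
  have hcardA : n + 1 ≤ 2 * A.card := by
    have h1 := Finset.card_le_card hAB
    have h2 := Finset.card_union_le A ((A.erase 0).image fun z => -z)
    have h3 : ((A.erase 0).image fun z => -z).card ≤ (A.erase 0).card := Finset.card_image_le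
    rw [Finset.card_erase_of_mem h0A] at h3
    have h4 : 0 < A.card := Finset.card_pos.2 ⟨0, h0A⟩
    omega
  have hA : ∀ a ∈ A, (hermiteOver ℝ n).eval a = 0 ∧ 0 ≤ a := by
    intro a ha
    obtain ⟨z, hz, rfl⟩ := Finset.mem_image.1 ha
    have hz := mem_roots_toFinset_hermiteOver.1 hz
    refine ⟨?_, abs_nonneg z⟩
    rcases abs_choice z with h | h
    · rw [h, hz]
    · rw [h, eval_neg_hermiteOver, hz, mul_zero]
  have hinj : Set.InjOn (fun z => (hermiteOver ℝ (n + 1)).eval z) A := by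
    intro x hx y hy hxy
    have hx' := hA x hx
    have hy' := hA y hy
    have := abs_eq_abs_of_sq_eval_hermiteOver_eq hx'.1 hy'.1 (by simp only at hxy; rw [hxy])
    rwa [abs_of_nonneg hx'.2, abs_of_nonneg hy'.2] at this
  have hcard := Finset.card_image_of_injOn hinj
  have : A.card ≤ (criticalValues (n + 1)).card := by
    rw [← hcard]
    refine Finset.card_le_card fun v hv => ?_
    obtain ⟨z, hz, rfl⟩ := Finset.mem_image.1 hv
    refine (mem_criticalValues_iff (Nat.succ_ne_zero _)).2 ⟨z, ?_, rfl⟩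
    rw [derivative_hermiteOver_succ, eval_mul, (hA z hz).1, mul_zero]
  omega

theorem card_criticalValues_le_natDegree {p : ℕ} {q : ℝ[X]} (hq : q ≠ 0)
    (h : ∀ v ∈ criticalValues p, q.eval v = 0) : (criticalValues p).card ≤ q.natDegree := by
  have h1 : (criticalValues p).val ⊆ q.roots := fun v hv => (mem_roots hq).2 (h v hv)
  exact card_le_degree_of_subset_roots h1

end CriticalValues

/-! ### Algebra of the integration-by-parts numerators. -/

section SteinNumerator

/-- The numerators `G_s` obtained when `(p h)⁻¹ d/dx` is repeatedly moved off the test function by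
Gaussian integration by parts: `G_s / (p ^ s h ^ (2 s))` is the coefficient left after `s` steps,
when `c 0, c 1, …` are the coefficients in order of decreasing order of differentiation. -/
noncomputable def steinNumerator {K : Type*} [CommRing K] (p : ℕ) (h : K[X]) (c : ℕ → K[X]) :
    ℕ → K[X]
  | 0 => c 0
  | s + 1 => (p : K[X]) ^ (s + 1) * h ^ (2 * (s + 1)) * c (s + 1) +
      ((X * steinNumerator p h c s - derivative (steinNumerator p h c s)) * h +
        ((2 * s + 1 : ℕ) : K[X]) * steinNumerator p h c s * derivative h)

theorem map_steinNumerator {K L : Type*} [CommRing K] [CommRing L] (φ : K →+* L) (p : ℕ)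
    (h : K[X]) (c : ℕ → K[X]) (s : ℕ) :
    (steinNumerator p h c s).map φ = steinNumerator p (h.map φ) (fun t => (c t).map φ) s := by
  induction s with
  | zero => rfl
  | succ s ih =>
    simp only [steinNumerator, Polynomial.map_add, Polynomial.map_mul, Polynomial.map_pow,
      Polynomial.map_sub, Polynomial.map_natCast, map_X, ← derivative_map, ih]

/-- At a zero of `h` only the term `(2s+1) G_s h'` of the recursion survives, so a nonzero value of
`G_0` would propagate to every `G_s`. -/
theorem eval_eq_zero_of_steinNumerator_eq_zero {K : Type*} [CommRing K] [IsDomain K] [CharZero K]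
    {p : ℕ} {h : K[X]} {c : ℕ → K[X]} {z : K} (hz : h.eval z = 0)
    (hz' : (derivative h).eval z ≠ 0) {s : ℕ} (hs : steinNumerator p h c s = 0) :
    (c 0).eval z = 0 := by
  by_contra h0
  suffices H : ∀ s, (steinNumerator p h c s).eval z ≠ 0 from H s (by rw [hs, eval_zero])
  intro s
  induction s with
  | zero => exact h0
  | succ s ih =>
    rw [steinNumerator]
    simp only [eval_add, eval_mul, eval_pow, hz, eval_natCast, mul_zero, zero_add,
      zero_pow (show 2 * (s + 1) ≠ 0 by omega), zero_mul]
    exact mul_ne_zero (mul_ne_zero (Nat.cast_ne_zero.2 (by omega)) ih) hz'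

/-- With `p = 0` the term in `c (s+1)` disappears, and `x h G_s` has larger degree than the other
terms. Monicity of `h` keeps degrees exact although `R` may have zero divisors. -/
theorem steinNumerator_ne_zero_of_natCast_eq_zero {R : Type*} [CommRing R] {p : ℕ}
    (hp : (p : R) = 0) {h : R[X]} (hm : h.Monic) {c : ℕ → R[X]} (hc : c 0 ≠ 0) (s : ℕ) :
    steinNumerator p h c s ≠ 0 := by
  have : Nontrivial R := by
    by_contra hR
    rw [not_nontrivial_iff_subsingleton] at hR
    exact hc (Subsingleton.elim _ _)
  have hp' : (p : R[X]) = 0 := by rw [← C_eq_natCast, hp, C_0]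
  induction s with
  | zero => exact hc
  | succ s ih =>
    intro H
    rw [steinNumerator, hp', zero_pow s.succ_ne_zero, zero_mul, zero_mul, zero_add] at H
    set G := steinNumerator p h c s
    have h1 : X * h * G =
        derivative G * h - ((2 * s + 1 : ℕ) : R[X]) * G * derivative h := by
      linear_combination H
    have hdeg : (X * h * G).natDegree = h.natDegree + 1 + G.natDegree := by
      rw [(monic_X.mul hm).natDegree_mul' ih, natDegree_X_mul hm.ne_zero]
    have hle : (derivative G * h -
        ((2 * s + 1 : ℕ) : R[X]) * G * derivative h).natDegree ≤ G.natDegree + h.natDegree := by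
      refine (natDegree_sub_le _ _).trans (max_le ?_ ?_)
      · exact natDegree_mul_le.trans
          (Nat.add_le_add_right ((natDegree_derivative_le G).trans (Nat.sub_le _ _)) _)
      · refine natDegree_mul_le.trans (Nat.add_le_add ?_
          ((natDegree_derivative_le h).trans (Nat.sub_le _ _)))
        refine natDegree_mul_le.trans ?_
        rw [natDegree_natCast, zero_add]
    rw [← h1, hdeg] at hle
    omega

/-- Reduction modulo `p` shows that `c 0` vanishes there; its cofactor by the monic `h` then
vanishes too. This step is what reaches `H' = p h` when `p` is not a unit of `K`. -/
theorem natCast_mul_dvd_of_steinNumerator_eq_zero {K : Type*} [CommRing K] {p : ℕ} {h : K[X]}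
    (hm : h.Monic) {c : ℕ → K[X]} (hdvd : h ∣ c 0) {s : ℕ} (hs : steinNumerator p h c s = 0) :
    (p : K[X]) * h ∣ c 0 := by
  obtain ⟨r, hr⟩ := hdvd
  set φ : K →+* K ⧸ Ideal.span {(p : K)} := Ideal.Quotient.mk _
  have hφp : (p : K ⧸ Ideal.span {(p : K)}) = 0 := by
    rw [← map_natCast φ, Ideal.Quotient.eq_zero_iff_mem]
    exact Ideal.mem_span_singleton_self _
  have h0 : (c 0).map φ = 0 := by
    by_contra hne
    refine steinNumerator_ne_zero_of_natCast_eq_zero hφp (hm.map φ)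
      (c := fun t => (c t).map φ) hne s ?_
    rw [← map_steinNumerator, hs, Polynomial.map_zero]
  have hr0 : r.map φ = 0 := by
    rw [hr, Polynomial.map_mul] at h0
    exact (hm.map φ).mul_right_eq_zero_iff.1 h0
  have hpr : (p : K[X]) ∣ r := by
    rw [← C_eq_natCast, C_dvd_iff_dvd_coeff]
    intro i
    rw [← Ideal.mem_span_singleton, ← Ideal.Quotient.eq_zero_iff_mem, ← coeff_map, hr0, coeff_zero]
  rw [hr, mul_comm (p : K[X])]
  exact mul_dvd_mul_left h hpr

theorem derivative_hermiteOver_dvd_of_steinNumerator_eq_zero {K : Type*} [CommRing K]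
    [Algebra K ℝ] (hK : Function.Injective (algebraMap K ℝ)) {n : ℕ} {c : ℕ → K[X]} {s : ℕ}
    (hs : steinNumerator (n + 1) (hermiteOver K n) c s = 0) :
    derivative (hermiteOver K (n + 1)) ∣ c 0 := by
  rw [derivative_hermiteOver_succ]
  refine natCast_mul_dvd_of_steinNumerator_eq_zero (hermiteOver_monic K n) ?_ hs
  rw [← map_dvd_map _ hK (hermiteOver_monic K n), map_hermiteOver]
  have hs' := congrArg (Polynomial.map (algebraMap K ℝ)) hs
  rw [map_steinNumerator, Polynomial.map_zero, map_hermiteOver] at hs'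
  exact hermiteOver_dvd_of_forall_root fun z hz =>
    eval_eq_zero_of_steinNumerator_eq_zero hz (eval_derivative_hermiteOver_ne_zero n hz) hs'

end SteinNumerator

/-! ### Smooth compactly supported test functions. -/

section TestFunctions

theorem iteratedDeriv_eq_zero_of_notMem_tsupport {f : ℝ → ℝ} {y : ℝ} (hy : y ∉ tsupport f)
    (k : ℕ) : iteratedDeriv k f y = 0 := by
  rw [(notMem_tsupport_iff_eventuallyEq.1 hy).iteratedDeriv_eq k]
  exact iteratedDeriv_const_zero

theorem iteratedDerivWithin_eq_iteratedDeriv_of_tsupport_subset {f : ℝ → ℝ} {I U : Set ℝ}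
    (hU : IsOpen U) (hUI : U ⊆ I) (hf : tsupport f ⊆ U) (k : ℕ) :
    iteratedDerivWithin k f I = iteratedDeriv k f := by
  funext y
  by_cases hy : y ∈ tsupport f
  · have h : I =ᶠ[nhds y] Set.univ :=
      Filter.eventuallyEq_univ.2 (Filter.mem_of_superset (hU.mem_nhds (hf hy)) hUI)
    rw [← iteratedDerivWithin_univ, iteratedDerivWithin, iteratedDerivWithin,
      iteratedFDerivWithin_congr_set h]
  · have h := notMem_tsupport_iff_eventuallyEq.1 hy
    rw [iteratedDeriv_eq_zero_of_notMem_tsupport hy,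
      (h.filter_mono nhdsWithin_le_nhds).iteratedDerivWithin_eq h.eq_of_nhds]
    exact iteratedDerivWithin_const_zero

theorem hasDerivAt_iteratedDeriv {f : ℝ → ℝ} (hf : ∀ n : ℕ, ContDiff ℝ n f) (k : ℕ) (y : ℝ) :
    HasDerivAt (iteratedDeriv k f) (iteratedDeriv (k + 1) f y) y := by
  rw [iteratedDeriv_succ]
  exact ((hf (k + 1)).differentiable_iteratedDeriv' k y).hasDerivAt

theorem isOpenPosMeasure_gaussianReal : (gaussianReal 0 1).IsOpenPosMeasure :=
  (gaussianReal_absolutelyContinuous' 0 one_ne_zero).isOpenPosMeasure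

variable {Ω : Type*} [MeasurableSpace Ω] {P : Measure Ω} {X : Ω → ℝ}

/-- The Gaussian charges every nonempty open set, so every neighbourhood of a value of `H` has
positive mass. -/
theorem range_subset_lawSupport_comp (hX : HasLaw X (gaussianReal 0 1) P) {H : ℝ → ℝ}
    (hH : Continuous H) : Set.range H ⊆ lawSupport P (fun ω => H (X ω)) := by
  rintro _ ⟨x, rfl⟩
  have hmap : P.map (fun ω => H (X ω)) = (gaussianReal 0 1).map H := by
    rw [← hX.map_eq, AEMeasurable.map_map_of_aemeasurable hH.aemeasurable hX.aemeasurable]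
    rfl
  rw [lawSupport, hmap, Measure.mem_support_iff_forall]
  intro U hU
  have := isOpenPosMeasure_gaussianReal
  exact (Measure.measure_pos_of_mem_nhds _ (hH.continuousAt hU)).trans_le
    (Measure.le_map_apply hH.aemeasurable U)

theorem integrable_comp_of_hasCompactSupport [IsFiniteMeasure P] {Y : Ω → ℝ}
    (hY : AEMeasurable Y P) {g : ℝ → ℝ} (hg : Continuous g) (hc : HasCompactSupport g) :
    Integrable (fun ω => g (Y ω)) P := by
  obtain ⟨C, hC⟩ := hg.bounded_above_of_compact_support hc
  exact Integrable.of_bound (hg.measurable.comp_aemeasurable hY).aestronglyMeasurable C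
    (Filter.Eventually.of_forall fun ω => hC _)

theorem IsPolynomialSteinOperator.integral_gaussianReal_eq_zero {K : Type*} [CommRing K]
    [Algebra K ℝ] (hX : HasLaw X (gaussianReal 0 1) P) {H : ℝ → ℝ} (hH : Continuous H)
    {T : ℕ} {c : Fin (T + 1) → K[X]} (hc : IsPolynomialSteinOperator P (fun ω => H (X ω)) c)
    {U : Set ℝ} (hU : IsOpen U) (hUH : U ⊆ Set.range H) {f : ℝ → ℝ}
    (hf : ∀ n : ℕ, ContDiff ℝ n f) (hfc : HasCompactSupport f) (hfU : tsupport f ⊆ U) :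
    ∫ x, ∑ t : Fin (T + 1), aeval (H x) (c t) * iteratedDeriv t f (H x) ∂(gaussianReal 0 1) = 0 := by
  have hP : IsProbabilityMeasure P := hX.isProbabilityMeasure
  have hUI := hUH.trans (range_subset_lawSupport_comp hX hH)
  have hD := iteratedDerivWithin_eq_iteratedDeriv_of_tsupport_subset hU hUI hfU
  have hYm : AEMeasurable (fun ω => H (X ω)) P := hH.measurable.comp_aemeasurable hX.aemeasurable
  have hDc : ∀ k, Continuous (iteratedDeriv k f) := fun k => (hf k).continuous_iteratedDeriv' k
  have hmem : f ∈ steinClass P (fun ω => H (X ω)) c := by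
    refine ⟨(hf T).contDiffOn, fun t _ j _ => ?_⟩
    rw [hD]
    refine integrable_comp_of_hasCompactSupport (g := fun y => y ^ j * iteratedDeriv t f y) hYm
      (by have := hDc t; fun_prop) ?_
    refine HasCompactSupport.intro hfc fun y hy => ?_
    rw [iteratedDeriv_eq_zero_of_notMem_tsupport hy, mul_zero]
  have h := (hc f hmem).2
  simp only [steinApply, hD] at h
  have hcont : Continuous fun x =>
      ∑ t : Fin (T + 1), aeval (H x) (c t) * iteratedDeriv t f (H x) := by
    refine continuous_finsetSum _ fun t _ => ?_
    have h1 := hDc t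
    have h2 : Continuous fun x => aeval (H x) (c t) := (c t).continuous_aeval.comp hH
    fun_prop
  exact (hX.integral_comp hcont.aestronglyMeasurable).symm.trans h

end TestFunctions

/-! ### Repeated Gaussian integration by parts. -/

section IntegrationByParts

/-- One integration by parts, as the derivative of its boundary term. The extra factor `p h` in the
denominator is the `H'` of the chain rule. -/
theorem hasDerivAt_steinNumerator {p : ℕ} (hp : p ≠ 0) {H h : ℝ[X]}
    (hHh : derivative H = (p : ℝ[X]) * h) (c : ℕ → ℝ[X]) {f : ℝ → ℝ}
    (hf : ∀ n : ℕ, ContDiff ℝ n f) (s k : ℕ) {x : ℝ} (hx : h.eval x ≠ 0) :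
    HasDerivAt (fun x : ℝ => (steinNumerator p h c s).eval x * Real.exp (-(x ^ 2 / 2)) /
        ((p : ℝ) ^ (s + 1) * h.eval x ^ (2 * s + 1)) * iteratedDeriv k f (H.eval x))
      (Real.exp (-(x ^ 2 / 2)) *
        ((steinNumerator p h c s).eval x / ((p : ℝ) ^ s * h.eval x ^ (2 * s)) *
            iteratedDeriv (k + 1) f (H.eval x) -
          (steinNumerator p h c (s + 1)).eval x / ((p : ℝ) ^ (s + 1) * h.eval x ^ (2 * (s + 1))) *
            iteratedDeriv k f (H.eval x) +
          (c (s + 1)).eval x * iteratedDeriv k f (H.eval x))) x := by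
  have hp' : (p : ℝ) ≠ 0 := Nat.cast_ne_zero.2 hp
  have hden : (p : ℝ) ^ (s + 1) * h.eval x ^ (2 * s + 1) ≠ 0 :=
    mul_ne_zero (pow_ne_zero _ hp') (pow_ne_zero _ hx)
  have h1 := hasDerivAt_eval_mul_exp_neg_sq (steinNumerator p h c s) x
  have h2 := ((h.hasDerivAt x).fun_pow (2 * s + 1)).const_mul ((p : ℝ) ^ (s + 1))
  have h3 := (hasDerivAt_iteratedDeriv hf k (H.eval x)).comp x (H.hasDerivAt x)
  refine ((h1.fun_div h2 hden).fun_mul h3).congr_deriv ?_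
  simp only [hHh, steinNumerator, eval_add, eval_mul, eval_sub, eval_pow, eval_natCast, eval_X,
    Function.comp]
  simp only [Nat.add_sub_cancel]
  push_cast
  field_simp
  ring

theorem integral_steinNumerator_eq {p : ℕ} (hp : p ≠ 0) {H h : ℝ[X]}
    (hHh : derivative H = (p : ℝ[X]) * h) (c : ℕ → ℝ[X]) {f : ℝ → ℝ}
    (hf : ∀ n : ℕ, ContDiff ℝ n f) {a b : ℝ} (hab : a ≤ b)
    (hh : ∀ x ∈ Set.Icc a b, h.eval x ≠ 0) (ha : H.eval a ∉ tsupport f)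
    (hb : H.eval b ∉ tsupport f) (T : ℕ) :
    ∫ x in a..b, Real.exp (-(x ^ 2 / 2)) *
        ((steinNumerator p h c T).eval x / ((p : ℝ) ^ T * h.eval x ^ (2 * T)) * f (H.eval x)) =
      ∫ x in a..b, Real.exp (-(x ^ 2 / 2)) *
        ∑ i ∈ Finset.range (T + 1), (c i).eval x * iteratedDeriv (T - i) f (H.eval x) := by
  have hDc : ∀ k, Continuous (iteratedDeriv k f) := fun k => (hf k).continuous_iteratedDeriv' k
  have hp' : (p : ℝ) ≠ 0 := Nat.cast_ne_zero.2 hp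
  have hfc : Continuous f := (hf 0).continuous
  have hS : Continuous fun x => Real.exp (-(x ^ 2 / 2)) *
      ∑ i ∈ Finset.range (T + 1), (c i).eval x * iteratedDeriv (T - i) f (H.eval x) := by
    have : Continuous fun x => ∑ i ∈ Finset.range (T + 1),
        (c i).eval x * iteratedDeriv (T - i) f (H.eval x) :=
      continuous_finsetSum _ fun i _ => by
        have := hDc (T - i)
        fun_prop
    fun_prop
  have hG : ContinuousOn (fun x => Real.exp (-(x ^ 2 / 2)) *
      ((steinNumerator p h c T).eval x / ((p : ℝ) ^ T * h.eval x ^ (2 * T)) * f (H.eval x)))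
      (Set.uIcc a b) := by
    rw [Set.uIcc_of_le hab]
    refine ContinuousOn.mul (by fun_prop) (ContinuousOn.mul (ContinuousOn.div (by fun_prop)
      (by fun_prop) fun x hx => ?_) (by fun_prop))
    exact mul_ne_zero (pow_ne_zero _ hp') (pow_ne_zero _ (hh x hx))
  rw [eq_comm, ← sub_eq_zero, ← intervalIntegral.integral_sub (hS.intervalIntegrable _ _)
    hG.intervalIntegrable]
  -- The sum of the `T` boundary terms is an antiderivative of the difference of the integrands: the
  -- numerator terms telescope. It vanishes at both endpoints, since `H(a)` and `H(b)` avoid the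
  -- support of `f`.
  have hderiv : ∀ x ∈ Set.uIcc a b, HasDerivAt
      (fun x => ∑ s ∈ Finset.range T,
        (steinNumerator p h c s).eval x * Real.exp (-(x ^ 2 / 2)) /
        ((p : ℝ) ^ (s + 1) * h.eval x ^ (2 * s + 1)) *
          iteratedDeriv (T - (s + 1)) f (H.eval x))
      (Real.exp (-(x ^ 2 / 2)) *
        (∑ i ∈ Finset.range (T + 1), (c i).eval x * iteratedDeriv (T - i) f (H.eval x)) -
        Real.exp (-(x ^ 2 / 2)) * ((steinNumerator p h c T).eval x /
          ((p : ℝ) ^ T * h.eval x ^ (2 * T)) * f (H.eval x))) x := by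
    intro x hx
    rw [Set.uIcc_of_le hab] at hx
    refine (HasDerivAt.fun_sum fun s _ =>
      hasDerivAt_steinNumerator hp hHh c hf s (T - (s + 1)) (hh x hx)).congr_deriv ?_
    have hstep : ∀ s ∈ Finset.range T, T - (s + 1) + 1 = T - s := fun s hs => by
      have := Finset.mem_range.1 hs
      omega
    rw [Finset.sum_congr rfl fun s hs => by rw [hstep s hs], ← Finset.mul_sum, ← mul_sub]
    congr 1
    rw [Finset.sum_add_distrib, Finset.sum_range_sub' (fun s =>
      (steinNumerator p h c s).eval x / ((p : ℝ) ^ s * h.eval x ^ (2 * s)) *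
            iteratedDeriv (T - s) f (H.eval x)), Finset.sum_range_succ']
    simp [steinNumerator]
    ring
  rw [intervalIntegral.integral_eq_sub_of_hasDerivAt hderiv (by
    exact (hS.intervalIntegrable _ _).sub hG.intervalIntegrable)]
  simp [iteratedDeriv_eq_zero_of_notMem_tsupport ha, iteratedDeriv_eq_zero_of_notMem_tsupport hb]

end IntegrationByParts

/-! ### Reduction to a single branch of `H`. -/

section Reduction

theorem eventually_sign_eval {q : ℝ[X]} (hq : q ≠ 0) :
    (∀ᶠ x in Filter.atTop, 0 < q.eval x) ∨ ∀ᶠ x in Filter.atTop, 0 < (-q).eval x := by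
  have key : ∀ r : ℝ[X], r ≠ 0 → 0 ≤ r.leadingCoeff → ∀ᶠ x in Filter.atTop, 0 < r.eval x := by
    intro r hr h
    rcases Nat.eq_zero_or_pos r.natDegree with h0 | h0
    · obtain ⟨a, rfl⟩ := natDegree_eq_zero.1 h0
      rw [leadingCoeff_C] at h
      refine Filter.Eventually.of_forall fun x => ?_
      rw [eval_C]
      exact lt_of_le_of_ne h fun h' => hr (by rw [← h', C_0])
    · exact (r.tendsto_atTop_of_leadingCoeff_nonneg (natDegree_pos_iff_degree_pos.1 h0)
        h).eventually_gt_atTop 0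
  rcases le_total 0 q.leadingCoeff with h | h
  · exact Or.inl (key q hq h)
  · exact Or.inr (key (-q) (neg_ne_zero.2 hq) (by rw [leadingCoeff_neg]; linarith))

theorem eventually_eval_hermiteOver_pos (n : ℕ) :
    ∀ᶠ x in Filter.atTop, 0 < (hermiteOver ℝ n).eval x := by
  rcases eventually_sign_eval (hermiteOver_monic ℝ n).ne_zero with h | h
  · exact h
  · rcases Nat.eq_zero_or_pos n with rfl | hn
    · exact Filter.Eventually.of_forall fun x => by simp [hermiteOver_zero]
    · refine ((hermiteOver ℝ n).tendsto_atTop_of_leadingCoeff_nonneg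
        (natDegree_pos_iff_degree_pos.1 ?_) ?_).eventually_gt_atTop 0
      · rwa [natDegree_hermiteOver]
      · rw [(hermiteOver_monic ℝ n).leadingCoeff]
        exact zero_le_one

/-- Far out to the right `H_{n+1}` dominates its values on the symmetric interval. -/
theorem eventually_hermiteOver_le_eval (n : ℕ) :
    ∀ᶠ a in Filter.atTop, ∀ x : ℝ, |x| ≤ a →
      (hermiteOver ℝ (n + 1)).eval x ≤ (hermiteOver ℝ (n + 1)).eval a := by
  set H := hermiteOver ℝ (n + 1) with hH
  obtain ⟨r, hr⟩ := Filter.eventually_atTop.1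
    ((eventually_eval_hermiteOver_pos n).and (eventually_eval_hermiteOver_pos (n + 1)))
  have hmono : MonotoneOn (fun x => H.eval x) (Set.Ici r) := by
    refine monotoneOn_of_deriv_nonneg (convex_Ici r) H.continuous.continuousOn
      H.differentiable.differentiableOn fun x hx => ?_
    rw [interior_Ici] at hx
    rw [Polynomial.deriv, hH, derivative_hermiteOver_succ, eval_mul, eval_natCast]
    exact mul_nonneg (Nat.cast_nonneg _) (hr x (le_of_lt hx)).1.le
  obtain ⟨B, hB⟩ := (isCompact_Icc (a := -r) (b := r)).bddAbove_image
    (f := fun x => H.eval x) H.continuous.continuousOn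
  have htop : Filter.Tendsto (fun x => H.eval x) Filter.atTop Filter.atTop := by
    refine H.tendsto_atTop_of_leadingCoeff_nonneg (natDegree_pos_iff_degree_pos.1 ?_) ?_
    · rw [hH, natDegree_hermiteOver]
      exact n.succ_pos
    · rw [hH, (hermiteOver_monic ℝ _).leadingCoeff]
      exact zero_le_one
  filter_upwards [htop.eventually_ge_atTop B, Filter.eventually_ge_atTop r] with a haB har x hx
  obtain ⟨hx1, hx2⟩ := abs_le.1 hx
  rcases le_or_gt r x with h | h
  · exact hmono h har hx2
  rcases le_or_gt (-r) x with h' | h'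
  · exact (hB ⟨x, ⟨h', h.le⟩, rfl⟩).trans haB
  · have hneg : H.eval x = (-1) ^ (n + 1) * H.eval (-x) := by
      rw [← eval_neg_hermiteOver, neg_neg]
    have hpos := (hr (-x) (by linarith)).2
    have hle : H.eval (-x) ≤ H.eval a := hmono (show r ≤ -x by linarith) har (by linarith)
    rcases neg_one_pow_eq_or ℝ (n + 1) with h1 | h1
    · rw [hneg, h1, one_mul]
      exact hle
    · rw [hneg, h1]
      linarith

theorem intervalIntegral_eq_zero_of_integral_gaussianReal_eq_zero {n : ℕ} {w : ℝ → ℝ}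
    (hw : Continuous w) {a b : ℝ} (ha : 0 ≤ a) (hab : a ≤ b)
    (hdom : ∀ x : ℝ, |x| ≤ a → (hermiteOver ℝ (n + 1)).eval x ≤ (hermiteOver ℝ (n + 1)).eval a)
    (hmono : MonotoneOn (fun x => (hermiteOver ℝ (n + 1)).eval x) (Set.Ici a))
    (hwsupp : ∀ y, y ∉ Set.Ioo ((hermiteOver ℝ (n + 1)).eval a) ((hermiteOver ℝ (n + 1)).eval b) →
      w y = 0)
    (hint : ∫ x, w ((hermiteOver ℝ (n + 1)).eval x) ∂(gaussianReal 0 1) = 0) :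
    ∫ x in a..b, Real.exp (-(x ^ 2 / 2)) * w ((hermiteOver ℝ (n + 1)).eval x) = 0 := by
  set H := hermiteOver ℝ (n + 1) with hH
  set F : ℝ → ℝ := fun x => Real.exp (-(x ^ 2 / 2)) * w (H.eval x) with hF
  have hFc : Continuous F := by fun_prop
  have hFI : ∫ x, F x = 0 := by
    rw [integral_gaussianReal_eq_integral_smul one_ne_zero] at hint
    have : ∀ x, gaussianPDFReal 0 1 x • w (H.eval x) = (√(2 * Real.pi))⁻¹ * F x := by
      intro x
      simp only [gaussianPDFReal, hF, smul_eq_mul, NNReal.coe_one, mul_one, sub_zero, mul_assoc,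
        neg_div]
    simp only [this, integral_const_mul] at hint
    refine (mul_eq_zero.1 hint).resolve_left ?_
    have := Real.pi_pos
    positivity
  have hFb : ∀ x, b ≤ x → F x = 0 := fun x hx => by
    have : H.eval b ≤ H.eval x := hmono hab (hab.trans hx) hx
    simp only [hF]
    rw [hwsupp _ fun h => absurd h.2 (not_lt.2 this), mul_zero]
  have hFa : ∀ x, |x| ≤ a → F x = 0 := fun x hx => by
    simp only [hF]
    rw [hwsupp _ fun h => absurd h.1 (not_lt.2 (hdom x hx)), mul_zero]
  -- Even degree makes the two half-lines contribute equally. In odd degree, `H(-x) ≤ -H(a) ≤ 0 ≤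
  -- H(a)` for `x ≥ a`, so the left half-line contributes nothing.
  have hFneg : (∀ x, F (-x) = F x) ∨ ∀ x, 0 < x → F (-x) = 0 := by
    rcases neg_one_pow_eq_or ℝ (n + 1) with h1 | h1
    · refine Or.inl fun x => ?_
      simp only [hF, hH, eval_neg_hermiteOver, h1, one_mul, neg_sq]
    · refine Or.inr fun x hx => ?_
      have hneg : ∀ x, H.eval (-x) = -H.eval x := fun x => by
        rw [hH, eval_neg_hermiteOver, h1, neg_one_mul]
      have ha0 : 0 ≤ H.eval a := by
        have := hdom (-a) (by rw [abs_neg, abs_of_nonneg ha])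
        rw [hneg] at this
        linarith
      rcases le_total x a with h | h
      · exact hFa _ (by rw [abs_neg, abs_of_pos hx]; exact h)
      · have hax : H.eval a ≤ H.eval x := hmono Set.self_mem_Ici h h
        simp only [hF]
        rw [hwsupp _ fun h' => ?_, mul_zero]
        have := h'.1
        rw [hneg] at this
        linarith
  have hsupp : HasCompactSupport F := by
    refine HasCompactSupport.intro (K := Set.Icc (-b) b) isCompact_Icc fun x hx => ?_
    rw [Set.mem_Icc, not_and_or, not_le, not_le] at hx
    rcases hx with h | h
    · rcases hFneg with h' | h'
      · rw [← h', hFb (-x) (by linarith)]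
      · have := h' (-x) (by linarith)
        rwa [neg_neg] at this
    · exact hFb x h.le
  have hFint : Integrable F := hFc.integrable_of_hasCompactSupport hsupp
  have hsplit := integral_add_compl (s := Set.Ioi (0 : ℝ)) measurableSet_Ioi hFint
  have hcompl : ∫ x in (Set.Ioi (0 : ℝ))ᶜ, F x = ∫ x in Set.Ioi (0 : ℝ), F (-x) := by
    rw [integral_comp_neg_Ioi, neg_zero, Set.compl_Ioi]
  have hIoi : ∫ x in Set.Ioi (0 : ℝ), F x = 0 := by
    rw [hFI, hcompl] at hsplit
    rcases hFneg with h' | h'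
    · simp only [h'] at hsplit
      linarith
    · rwa [setIntegral_congr_fun (g := fun _ => (0 : ℝ)) measurableSet_Ioi fun x hx => h' x hx,
        integral_zero, add_zero] at hsplit
  rw [intervalIntegral.integral_of_le hab]
  rw [← hIoi]
  refine (setIntegral_eq_of_subset_of_forall_sdiff_eq_zero measurableSet_Ioi
    (fun x hx => ha.trans_lt hx.1) fun x hx => ?_).symm
  have hx0 : 0 < x := hx.1
  rcases le_total x a with h | h
  · exact hFa x (by rwa [abs_of_pos hx0])
  · rcases le_total b x with h' | h'
    · exact hFb x h'
    · rcases h.eq_or_lt with h'' | h''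
      · exact hFa x (by rw [abs_of_pos hx0, h''])
      · exact absurd ⟨h'', h'⟩ hx.2

theorem intervalIntegral_exp_mul_div_mul_comp_pos {a b : ℝ} (hab : a < b) {q r H : ℝ[X]}
    (hq : ∀ x ∈ Set.Icc a b, 0 < q.eval x) (hr : ∀ x ∈ Set.Icc a b, 0 < r.eval x)
    {f : ℝ → ℝ} (hfc : Continuous f) (hf0 : ∀ y, 0 ≤ f y) {x₀ : ℝ} (hx₀ : x₀ ∈ Set.Icc a b)
    (hfx : 0 < f (H.eval x₀)) :
    0 < ∫ x in a..b, Real.exp (-(x ^ 2 / 2)) * (q.eval x / r.eval x * f (H.eval x)) := by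
  refine intervalIntegral.integral_pos hab ?_ (fun x hx => ?_) ⟨x₀, hx₀, ?_⟩
  · refine ContinuousOn.mul (by fun_prop) (ContinuousOn.mul (ContinuousOn.div (by fun_prop)
      (by fun_prop) fun x hx => (hr x hx).ne') (by fun_prop))
  · have h := Set.Ioc_subset_Icc_self hx
    exact mul_nonneg (Real.exp_pos _).le
      (mul_nonneg (div_nonneg (hq x h).le (hr x h).le) (hf0 _))
  · exact mul_pos (Real.exp_pos _) (mul_pos (div_pos (hq _ hx₀) (hr _ hx₀)) hfx)

end Reduction

/-! ### The leading coefficient of a Stein operator. -/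

section LeadingCoefficient

variable {Ω : Type*} [MeasurableSpace Ω] {P : Measure Ω} {X : Ω → ℝ}

theorem steinNumerator_eq_zero_of_isPolynomialSteinOperator {K : Type*} [CommRing K] [Algebra K ℝ]
    (hK : Function.Injective (algebraMap K ℝ)) (hX : HasLaw X (gaussianReal 0 1) P) {n T : ℕ}
    {c : Fin (T + 1) → K[X]}
    (hc : IsPolynomialSteinOperator P (fun ω => (hermiteOver ℝ (n + 1)).eval (X ω)) c) :
    steinNumerator (n + 1) (hermiteOver K n)
      (fun i => aeval (hermiteOver K (n + 1)) (c ⟨T - i, by omega⟩)) T = 0 := by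
  refine map_injective _ hK ?_
  rw [map_steinNumerator, Polynomial.map_zero, map_hermiteOver]
  set H := hermiteOver ℝ (n + 1) with hH
  set h := hermiteOver ℝ n with hh
  set d : ℕ → ℝ[X] := fun i =>
    (aeval (hermiteOver K (n + 1)) (c ⟨T - i, by omega⟩)).map (algebraMap K ℝ) with hd
  have hdeval : ∀ i x, (d i).eval x = aeval (H.eval x) (c ⟨T - i, by omega⟩) := by
    intro i x
    simp only [hd]
    rw [← comp_eq_aeval, map_comp, map_hermiteOver, eval_comp, eval_map_algebraMap]
  by_contra hG
  set G := steinNumerator (n + 1) h d T with hGdef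
  have hHh : derivative H = ((n + 1 : ℕ) : ℝ[X]) * h := derivative_hermiteOver_succ ℝ n
  obtain ⟨a, ha⟩ : ∃ a : ℝ, 0 ≤ a ∧ (∀ x : ℝ, |x| ≤ a → H.eval x ≤ H.eval a) ∧
      (∀ x, a ≤ x → 0 < h.eval x) ∧
      ((∀ x, a ≤ x → 0 < G.eval x) ∨ ∀ x, a ≤ x → 0 < (-G).eval x) := by
    have hpos := Filter.eventually_forall_ge_atTop.2 (eventually_eval_hermiteOver_pos n)
    have h0 := (Filter.eventually_ge_atTop (0 : ℝ)).and
      ((eventually_hermiteOver_le_eval n).and hpos)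
    rcases eventually_sign_eval hG with hs | hs
    · obtain ⟨a, h1, h2⟩ := (h0.and (Filter.eventually_forall_ge_atTop.2 hs)).exists
      exact ⟨a, h1.1, h1.2.1, h1.2.2, Or.inl h2⟩
    · obtain ⟨a, h1, h2⟩ := (h0.and (Filter.eventually_forall_ge_atTop.2 hs)).exists
      exact ⟨a, h1.1, h1.2.1, h1.2.2, Or.inr h2⟩
  obtain ⟨ha0, hdom, hhpos, hsign⟩ := ha
  set b := a + 1 with hb
  have hab : a < b := by linarith
  have hmono : StrictMonoOn (fun x => H.eval x) (Set.Ici a) := by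
    refine strictMonoOn_of_deriv_pos (convex_Ici a) H.continuous.continuousOn fun x hx => ?_
    rw [interior_Ici] at hx
    rw [Polynomial.deriv, hHh, eval_mul, eval_natCast]
    exact mul_pos (Nat.cast_pos.2 n.succ_pos) (hhpos x (le_of_lt hx))
  have hHab : H.eval a < H.eval b := hmono Set.self_mem_Ici hab.le hab
  have hivt : Set.Icc (H.eval a) (H.eval b) ⊆ (fun x => H.eval x) '' Set.Icc a b :=
    intermediate_value_Icc hab.le H.continuous.continuousOn
  -- The radii are an eighth and a quarter of the interval's length, so the closed support stays
  -- strictly inside it.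
  let f : ContDiffBump ((H.eval a + H.eval b) / 2) :=
    ⟨(H.eval b - H.eval a) / 8, (H.eval b - H.eval a) / 4, by linarith, by linarith⟩
  have hfsupp : tsupport f ⊆ Set.Ioo (H.eval a) (H.eval b) := by
    rw [f.tsupport_eq, Real.closedBall_eq_Icc]
    intro y hy
    have hR : f.rOut = (H.eval b - H.eval a) / 4 := rfl
    rw [hR] at hy
    exact ⟨by linarith [hy.1], by linarith [hy.2]⟩
  have hfsm : ∀ k : ℕ, ContDiff ℝ k f := fun k => f.contDiff
  have hStein := hc.integral_gaussianReal_eq_zero hX H.continuous isOpen_Ioo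
    (fun y hy => by
      obtain ⟨x, -, hx⟩ := hivt (Set.Ioo_subset_Icc_self hy)
      exact ⟨x, hx⟩) hfsm f.hasCompactSupport hfsupp
  have hzero := intervalIntegral_eq_zero_of_integral_gaussianReal_eq_zero (n := n)
    (w := fun y => ∑ t : Fin (T + 1), aeval y (c t) * iteratedDeriv t f y)
    (continuous_finsetSum _ fun t _ =>
      (c t).continuous_aeval.mul ((hfsm t).continuous_iteratedDeriv' t))
    ha0 hab.le hdom hmono.monotoneOn
    (fun y hy => Finset.sum_eq_zero fun t _ => by
      rw [iteratedDeriv_eq_zero_of_notMem_tsupport (fun h' => hy (hfsupp h')), mul_zero]) hStein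
  have hsum : ∀ x : ℝ, ∑ i ∈ Finset.range (T + 1),
      (d i).eval x * iteratedDeriv (T - i) f (H.eval x) =
      ∑ t : Fin (T + 1), aeval (H.eval x) (c t) * iteratedDeriv t f (H.eval x) := by
    intro x
    -- The numerators list coefficients by decreasing order of differentiation, so the index is
    -- reversed.
    rw [Finset.sum_range, ← Equiv.sum_comp Fin.revPerm fun t : Fin (T + 1) =>
      aeval (H.eval x) (c t) * iteratedDeriv t f (H.eval x)]
    refine Finset.sum_congr rfl fun i _ => ?_
    have hi : (Fin.rev i : Fin (T + 1)) = ⟨T - i, by omega⟩ := by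
      ext
      rw [Fin.val_rev]
      simp
    rw [Fin.revPerm_apply, hi, hdeval]
  have hparts := integral_steinNumerator_eq n.succ_ne_zero hHh d hfsm hab.le
    (fun x hx => (hhpos x hx.1).ne') (fun h' => (hfsupp h').1.false)
    (fun h' => (hfsupp h').2.false) T
  simp only [hsum] at hparts
  rw [hzero, ← hGdef] at hparts
  obtain ⟨x₀, hx₀, hHx₀⟩ := hivt
    (show (H.eval a + H.eval b) / 2 ∈ Set.Icc _ _ from ⟨by linarith, by linarith⟩)
  have hfx₀ : 0 < f (H.eval x₀) := by
    simp only at hHx₀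
    rw [hHx₀]
    exact f.pos_of_mem_ball (Metric.mem_ball_self f.rOut_pos)
  set r : ℝ[X] := C (((n + 1 : ℕ) : ℝ) ^ T) * h ^ (2 * T) with hr
  have hreval : ∀ x, r.eval x = ((n + 1 : ℕ) : ℝ) ^ T * h.eval x ^ (2 * T) := fun x => by
    rw [hr, eval_mul, eval_C, eval_pow]
  have hrpos : ∀ x ∈ Set.Icc a b, 0 < r.eval x := fun x hx => by
    rw [hreval]
    have := hhpos x hx.1
    positivity
  simp only [Nat.succ_eq_add_one, ← hreval] at hparts
  rcases hsign with hs | hs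
  · exact (intervalIntegral_exp_mul_div_mul_comp_pos hab (fun x hx => hs x hx.1) hrpos f.continuous
      (fun y => f.nonneg) hx₀ hfx₀).ne' hparts
  · refine (intervalIntegral_exp_mul_div_mul_comp_pos hab (fun x hx => hs x hx.1) hrpos f.continuous
      (fun y => f.nonneg) hx₀ hfx₀).ne' ?_
    simp only [eval_neg, neg_div, neg_mul, mul_neg, intervalIntegral.integral_neg, hparts, neg_zero]

theorem derivative_hermiteOver_dvd_of_isPolynomialSteinOperator {K : Type*} [CommRing K]
    [Algebra K ℝ] (hK : Function.Injective (algebraMap K ℝ)) (hX : HasLaw X (gaussianReal 0 1) P)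
    {p : ℕ} (hp : p ≠ 0) {T : ℕ} {c : Fin (T + 1) → K[X]}
    (hc : IsPolynomialSteinOperator P (fun ω => (hermiteOver ℝ p).eval (X ω)) c) :
    derivative (hermiteOver K p) ∣ aeval (hermiteOver K p) (c (Fin.last T)) := by
  obtain ⟨n, rfl⟩ := Nat.exists_eq_succ_of_ne_zero hp
  exact derivative_hermiteOver_dvd_of_steinNumerator_eq_zero hK
    (steinNumerator_eq_zero_of_isPolynomialSteinOperator hK hX hc)

end LeadingCoefficient

theorem mainTheorem2 {K : Type*} [CommRing K] [Algebra K ℝ]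
    (hK : Function.Injective (algebraMap K ℝ))
    {Ω : Type*} [MeasurableSpace Ω] (P : Measure Ω) (X : Ω → ℝ)
    (hX : HasLaw X (gaussianReal 0 1) P) (p : ℕ) (hp : 2 ≤ p) :
    ((Subtype.val '' (criticalIdeal K p : Set (hermiteSubring K p)) : Set K[X]) =
        (hermiteSubring K p : Set K[X]) ∩
          (Ideal.span {derivative (hermiteOver K p)} : Ideal K[X])) ∧
    (IsField K →
      ∃ t : K[X], t.map (algebraMap K ℝ) = criticalPolynomial p ∧
        criticalIdeal K p = Ideal.span {aeval (hermiteVar K p) t}) ∧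
    ∀ (T : ℕ) (c : Fin (T + 1) → K[X]),
      IsPolynomialSteinOperator P (fun ω => (hermiteOver ℝ p).eval (X ω)) c →
        aeval (hermiteVar K p) (c (Fin.last T)) ∈ criticalIdeal K p ∧
        (∀ x : ℝ, (derivative (hermiteOver ℝ p)).eval x = 0 →
          aeval ((hermiteOver ℝ p).eval x) (c (Fin.last T)) = 0) ∧
        (∀ x : ℝ, IsLocalExtr (fun z : ℝ => (hermiteOver ℝ p).eval z) x →
          aeval ((hermiteOver ℝ p).eval x) (c (Fin.last T)) = 0) ∧
        (c (Fin.last T) ≠ 0 →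
          (Even p → (p : ℝ) / 2 ≤ (c (Fin.last T)).natDegree) ∧
          (Odd p → (p : ℝ) - 1 ≤ (c (Fin.last T)).natDegree)) := by
  have hp0 : p ≠ 0 := by omega
  refine ⟨image_criticalIdeal K p, fun hF => ?_, fun T c hc => ?_⟩
  · let := hF.toField
    exact exists_map_eq_criticalPolynomial hp0
  have hdvd := derivative_hermiteOver_dvd_of_isPolynomialSteinOperator hK hX hp0 hc
  have hroot : ∀ x : ℝ, (derivative (hermiteOver ℝ p)).eval x = 0 →
      aeval ((hermiteOver ℝ p).eval x) (c (Fin.last T)) = 0 := by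
    intro x hx
    have h := Polynomial.map_dvd (algebraMap K ℝ) hdvd
    rw [← derivative_map, ← comp_eq_aeval, map_comp, map_hermiteOver] at h
    have h0 := (derivative_hermiteOver_dvd_iff_forall_root hp0).1 h x hx
    rwa [eval_comp, eval_map_algebraMap] at h0
  refine ⟨?_, hroot, fun x hx => hroot x ?_, fun hne => ?_⟩
  · rwa [mem_criticalIdeal_iff, coe_aeval_hermiteVar]
  · rw [← Polynomial.deriv]
    exact hx.deriv_eq_zero
  -- All critical values are roots of the nonzero polynomial `p_T`.
  have hcard : (criticalValues p).card ≤ (c (Fin.last T)).natDegree := by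
    rw [← natDegree_map_eq_of_injective hK]
    refine card_criticalValues_le_natDegree ((Polynomial.map_ne_zero_iff hK).2 hne) fun v hv => ?_
    obtain ⟨z, hz, rfl⟩ := (mem_criticalValues_iff hp0).1 hv
    rw [eval_map_algebraMap]
    exact hroot z hz
  constructor
  · intro he
    have h := (le_two_mul_card_criticalValues_of_even hp0 he).trans (Nat.mul_le_mul_left 2 hcard)
    have h' : (p : ℝ) ≤ 2 * ((c (Fin.last T)).natDegree : ℝ) := by exact_mod_cast h
    linarith
  · intro ho
    have h := (le_card_criticalValues_of_odd ho).trans hcard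
    have h' : p ≤ (c (Fin.last T)).natDegree + 1 := by omega
    have h'' : (p : ℝ) ≤ ((c (Fin.last T)).natDegree : ℝ) + 1 := by exact_mod_cast h'
    linarith
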